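/- Let $R$ be a commutative Noetherian ring with identity and let $D$ be a (unitary) $R$-module. Call an injective $R$-linear map $f : M \to N$ *pure* if $f \otimes \mathrm{id}_L : M \otimes_R L \to N \otimes_R L$ is injective for every $R$-module $L$, and call $D$ *pure injective* if for every pure $R$-linear map $f : M \to N$ the induced map $\operatorname{Hom}_R(N,D) \to \operatorname{Hom}_R(M,D)$, $h \mapsto h \circ f$, is surjective. Then $D$ is pure injective if and only if there is a family $(A_i)_{i \in I}$ of Artinian $R$-modules such that $D$ is isomorphic to a direct summand of the direct product $\prod_{i \in I} A_i$. -/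

import Mathlib

universe u v w₁ w₂

/-- An `R`-linear map `f : M → N` is pure if it is injective and `f ⊗ id_L : M ⊗ L → N ⊗ L` is
injective for every `R`-module `L`. -/
def LinearMap.IsPureMono {R : Type u} [CommRing R] {M : Type w₁} {N : Type w₂}
    [AddCommGroup M] [Module R M] [AddCommGroup N] [Module R N] (f : M →ₗ[R] N) : Prop :=
  Function.Injective f ∧
    ∀ (L : Type (max u w₁ w₂)) [AddCommGroup L] [Module R L], Function.Injective (f.rTensor L)

/-- An `R`-module `D` is pure injective if for every pure homomorphism `f : M → N` the induced map
`Hom(N, D) → Hom(M, D)`, `h ↦ h ∘ f`, is surjective. -/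
def Module.IsPureInjective (R : Type u) [CommRing R] (D : Type v) [AddCommGroup D]
    [Module R D] : Prop :=
  ∀ (M N : Type (max u v)) [AddCommGroup M] [Module R M] [AddCommGroup N] [Module R N]
    (f : M →ₗ[R] N), f.IsPureMono →
      Function.Surjective (fun h : N →ₗ[R] D => h ∘ₗ f)

/-- `D` is isomorphic to a direct summand of `P`. -/
def Module.IsIsoDirectSummand (R : Type u) [CommRing R] (D : Type w₁) (P : Type w₂)
    [AddCommGroup D] [Module R D] [AddCommGroup P] [Module R P] : Prop :=
  ∃ C C' : Submodule R P, IsCompl C C' ∧ Nonempty (D ≃ₗ[R] C)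

/-! Purity means that finite linear systems with constants in the source gain no solvability in the
target. Over a commutative ring their solution sets in a module are cosets of submodules, so in an
Artinian module one element meets all conditions imposed by an element of `N`; Zorn then extends
maps along pure monomorphisms. Hence Artinian modules, their products and summands of these are pure
injective. Conversely, `D` embeds purely in a product of Artinian modules, and pure injectivity
splits the embedding. Nonzero tensors in `D ⊗ Q`, `Q` finitely generated, survive in an Artinian
quotient `T` of `D ⊗ Q`, hence along `D → Hom(Q, T)`. Such quotients exist since a module whose
nonzero submodules share a nonzero element is Artinian: its submodules embed, order reversed, in the
ideals of a Noetherian Rees algebra. -/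

/-! ### Purity and linear systems -/

/-- Solvability in `M` of the finite linear system `∑ j, r i j • x j = b i`. -/
def Module.IsSolvable {R : Type*} {M : Type*} [CommRing R] [AddCommGroup M] [Module R M]
    {ι κ : Type} [Fintype κ] (r : ι → κ → R) (b : ι → M) : Prop :=
  ∃ x : κ → M, ∀ i, ∑ j, r i j • x j = b i

/-- Systems solvable in the target of a pure map are solvable in its source. -/
theorem LinearMap.IsPureMono.isSolvable {R : Type u} [CommRing R] {M : Type w₁} {N : Type w₂}
    [AddCommGroup M] [Module R M] [AddCommGroup N] [Module R N] {f : M →ₗ[R] N}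
    (hf : f.IsPureMono) {ι κ : Type} [Fintype ι] [Fintype κ] (r : ι → κ → R) (b : ι → M)
    (h : Module.IsSolvable r (fun i => f (b i))) : Module.IsSolvable r b := by
  classical
  obtain ⟨x, hx⟩ := h
  -- The columns of `r` span `S`; solvability amounts to the vanishing of `∑ b i ⊗ e i` over the
  -- quotient by `S`.
  let S : Submodule R (ι → R) := Submodule.span R (Set.range fun j i => r i j)
  let q : (ι → R) →ₗ[R] ULift.{max u w₁ w₂} ((ι → R) ⧸ S) :=
    ULift.moduleEquiv.symm.toLinearMap ∘ₗ S.mkQ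
  have hq (c : ι → R) : q c = 0 ↔ c ∈ S := by
    rw [← Submodule.Quotient.mk_eq_zero S]
    exact ULift.moduleEquiv.symm.map_eq_zero_iff
  let e : ι → ULift.{max u w₁ w₂} ((ι → R) ⧸ S) := fun i => q (Pi.single i 1)
  have key (c : ι → R) : ∑ i, c i • e i = q c := by
    simp only [e, ← map_smul, ← map_sum]
    congr 1
    exact (pi_eq_sum_univ' c).symm
  have hspan : Submodule.span R (Set.range e) = ⊤ := by
    rw [eq_top_iff]
    rintro ⟨y⟩ -
    obtain ⟨c, rfl⟩ := S.mkQ_surjective y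
    change q c ∈ _
    rw [← key]
    exact Submodule.sum_mem _ fun i _ =>
      Submodule.smul_mem _ _ (Submodule.subset_span ⟨i, rfl⟩)
  have hzero : ∑ i, b i ⊗ₜ[R] e i = 0 := by
    apply hf.2 (ULift.{max u w₁ w₂} ((ι → R) ⧸ S))
    simp only [map_sum, LinearMap.rTensor_tmul, map_zero, ← hx, TensorProduct.sum_tmul,
      TensorProduct.smul_tmul]
    rw [Finset.sum_comm]
    refine Finset.sum_eq_zero fun j _ => ?_
    rw [← TensorProduct.tmul_sum, key, (hq _).2 (Submodule.subset_span ⟨j, rfl⟩),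
      TensorProduct.tmul_zero]
  have hzero' : ∑ i, e i ⊗ₜ[R] b i = 0 := by
    simpa using congrArg (TensorProduct.comm R _ _) hzero
  obtain ⟨k, a, y, hb, ha⟩ := TensorProduct.vanishesTrivially_of_sum_tmul_eq_zero R hspan hzero'
  have ha' (l : Fin k) : ∃ c : κ → R, ∀ i, ∑ j, c j * r i j = a i l := by
    have : (fun i => a i l) ∈ S := by rw [← hq, ← key]; exact ha l
    obtain ⟨c, hc⟩ := (Submodule.mem_span_range_iff_exists_fun R).1 this
    exact ⟨c, fun i => by simpa using congrFun hc i⟩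
  choose c hc using ha'
  refine ⟨fun j => ∑ l, c l j • y l, fun i => ?_⟩
  simp only [hb, ← hc, Finset.smul_sum, Finset.sum_smul, smul_smul]
  rw [Finset.sum_comm]
  simp only [mul_comm]

/-! ### Consistent relations and extension into Artinian modules -/

/-- A linear relation between `N` and `A` is consistent if it carries the constants of finite
systems solvable in `N` to constants of systems solvable in `A`. -/
def Submodule.IsConsistent {R N A : Type*} [CommRing R] [AddCommGroup N] [Module R N]
    [AddCommGroup A] [Module R A] (G : Submodule R (N × A)) : Prop :=
  ∀ (ι κ : Type) [Fintype ι] [Fintype κ] (r : ι → κ → R) (p : ι → N × A), (∀ i, p i ∈ G) →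
    Module.IsSolvable r (fun i => (p i).1) → Module.IsSolvable r (fun i => (p i).2)

/-- A finite linear system in one distinguished unknown, with right-hand sides
`p i + s i • (distinguished unknown)` where the constants `p i` lie in a relation `G`. -/
structure Submodule.PointedSystem {R N A : Type*} [CommRing R] [AddCommGroup N] [Module R N]
    [AddCommGroup A] [Module R A] (G : Submodule R (N × A)) where
  ι : Type
  κ : Type
  [fι : Fintype ι]
  [fκ : Fintype κ]
  r : ι → κ → R
  s : ι → R
  p : ι → N × A
  hp : ∀ i, p i ∈ G

namespace Submodule.PointedSystem

variable {R N A : Type*} [CommRing R] [AddCommGroup N] [Module R N]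
    [AddCommGroup A] [Module R A] {G : Submodule R (N × A)}

attribute [instance] fι fκ

/-- The element `n` satisfies the system in `N`. -/
def Holds (t : G.PointedSystem) (n : N) : Prop :=
  Module.IsSolvable t.r (fun i => (t.p i).1 + t.s i • n)

/-- The solution set of the system in `A`. -/
def sol (t : G.PointedSystem) : Set A :=
  {a | Module.IsSolvable t.r (fun i => (t.p i).2 + t.s i • a)}

/-- The solutions in `A` of the associated homogeneous system. -/
def hom (t : G.PointedSystem) : Submodule R A where
  carrier := {a | Module.IsSolvable t.r (fun i => t.s i • a)}
  add_mem' := by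
    rintro a b ⟨x, hx⟩ ⟨y, hy⟩
    exact ⟨x + y, fun i => by simp [smul_add, Finset.sum_add_distrib, hx, hy]⟩
  zero_mem' := ⟨0, fun i => by simp⟩
  smul_mem' := by
    rintro c a ⟨x, hx⟩
    refine ⟨c • x, fun i => ?_⟩
    simp only [Pi.smul_apply, smul_comm _ c, ← Finset.smul_sum, hx]

theorem sub_mem_hom (t : G.PointedSystem) {a b : A} (ha : a ∈ t.sol) (hb : b ∈ t.sol) :
    a - b ∈ t.hom := by
  obtain ⟨x, hx⟩ := ha
  obtain ⟨y, hy⟩ := hb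
  exact ⟨x - y, fun i => by simp [smul_sub, Finset.sum_sub_distrib, hx, hy]⟩

theorem add_mem_sol (t : G.PointedSystem) {a b : A} (ha : a ∈ t.hom) (hb : b ∈ t.sol) :
    a + b ∈ t.sol := by
  obtain ⟨x, hx⟩ := ha
  obtain ⟨y, hy⟩ := hb
  exact ⟨x + y, fun i => by simp [smul_add, Finset.sum_add_distrib, hx, hy]; abel⟩

theorem sol_nonempty (hG : G.IsConsistent) (t : G.PointedSystem) {n : N} (h : t.Holds n) :
    t.sol.Nonempty := by
  obtain ⟨x, hx⟩ := h
  -- The distinguished unknown moves to the left as the variable `none`, with coefficient `-s i`.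
  obtain ⟨y, hy⟩ := hG t.ι (Option t.κ) (fun i j => j.elim (-t.s i) (t.r i)) t.p t.hp
    ⟨fun j => j.elim n x, fun i => by simp [Fintype.sum_option, hx]⟩
  refine ⟨y none, fun j => y (some j), fun i => ?_⟩
  have := hy i
  simp only [Fintype.sum_option, Option.elim, neg_smul] at this
  change _ = (t.p i).2 + t.s i • y none
  rw [← this]
  abel

/-- The conjunction of two systems. -/
def and (t t' : G.PointedSystem) : G.PointedSystem where
  ι := t.ι ⊕ t'.ι
  κ := t.κ ⊕ t'.κ
  r := Sum.elim (fun i => Sum.elim (t.r i) 0) (fun i => Sum.elim 0 (t'.r i))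
  s := Sum.elim t.s t'.s
  p := Sum.elim t.p t'.p
  hp := by rintro (i | i); exacts [t.hp i, t'.hp i]

theorem and_holds {t t' : G.PointedSystem} {n : N} (h : t.Holds n) (h' : t'.Holds n) :
    (t.and t').Holds n := by
  obtain ⟨x, hx⟩ := h
  obtain ⟨y, hy⟩ := h'
  refine ⟨Sum.elim x y, ?_⟩
  change ∀ i : t.ι ⊕ t'.ι, ∑ j : t.κ ⊕ t'.κ, _ = _
  rintro (i | i) <;> simp [and, hx, hy]

theorem sol_and {t t' : G.PointedSystem} {a : A} (h : a ∈ (t.and t').sol) :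
    a ∈ t.sol ∧ a ∈ t'.sol := by
  obtain ⟨x, hx⟩ := h
  change ∀ i : t.ι ⊕ t'.ι, ∑ j : t.κ ⊕ t'.κ, _ = _ at hx
  exact ⟨⟨fun j => x (Sum.inl j), fun i => by simpa [and] using hx (Sum.inl i)⟩,
    ⟨fun j => x (Sum.inr j), fun i => by simpa [and] using hx (Sum.inr i)⟩⟩

theorem hom_and_le {t t' : G.PointedSystem} : (t.and t').hom ≤ t.hom := by
  rintro a ⟨x, hx⟩
  change ∀ i : t.ι ⊕ t'.ι, ∑ j : t.κ ⊕ t'.κ, _ = _ at hx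
  exact ⟨fun j => x (Sum.inl j), fun i => by simpa [and] using hx (Sum.inl i)⟩

/-- If `A` is Artinian, one element of `A` satisfies all systems satisfied by `n`. -/
theorem exists_forall_mem_sol [IsArtinian R A] (hG : G.IsConsistent) (n : N) :
    ∃ a : A, ∀ t : G.PointedSystem, t.Holds n → a ∈ t.sol := by
  have hne : (hom '' {t : G.PointedSystem | t.Holds n}).Nonempty :=
    ⟨_, _, show Holds ⟨Empty, Empty, Empty.elim, Empty.elim, Empty.elim, (·.elim)⟩ n from
      ⟨Empty.elim, (·.elim)⟩, rfl⟩
  -- With `t.hom` minimal, adding further equations cannot shrink the coset `t.sol`.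
  obtain ⟨_, ⟨t, ht, rfl⟩, hmin⟩ := IsArtinian.set_has_minimal _ hne
  obtain ⟨a, ha⟩ := sol_nonempty hG t ht
  refine ⟨a, fun t' ht' => ?_⟩
  have hand := and_holds ht ht'
  obtain ⟨b, hb⟩ := sol_nonempty hG _ hand
  have heq : (t.and t').hom = t.hom := by
    by_contra hne
    exact hmin _ ⟨_, hand, rfl⟩ (lt_of_le_of_ne hom_and_le hne)
  have := t.sub_mem_hom ha (sol_and hb).1
  rw [← heq] at this
  simpa using (sol_and (add_mem_sol _ this hb)).2

end Submodule.PointedSystem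

/-- Homomorphisms into an Artinian module over a commutative ring extend along pure maps. -/
theorem LinearMap.IsPureMono.exists_extension_of_isArtinian {R : Type u} [CommRing R]
    {M : Type w₁} {N : Type w₂} [AddCommGroup M] [Module R M] [AddCommGroup N] [Module R N]
    {f : M →ₗ[R] N} (hf : f.IsPureMono) {A : Type*} [AddCommGroup A] [Module R A]
    [IsArtinian R A] (g : M →ₗ[R] A) : ∃ h : N →ₗ[R] A, h ∘ₗ f = g := by
  have h₀ : (LinearMap.range (f.prod g)).IsConsistent := by
    intro ι κ _ _ r p hp hs
    choose m hm using hp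
    obtain rfl : (fun i => f.prod g (m i)) = p := funext hm
    obtain ⟨x, hx⟩ := hf.isSolvable r m hs
    refine ⟨fun j => g (x j), fun i => ?_⟩
    change _ = g (m i)
    simp [← hx]
  obtain ⟨G, hle, hG⟩ := zorn_le_nonempty₀ {G : Submodule R (N × A) | G.IsConsistent}
    (by
      intro c hc hchain G₀ hG₀
      refine ⟨sSup c, ?_, fun G hG => le_sSup hG⟩
      intro ι κ _ _ r p hp hs
      have : ∃ G ∈ c, ∀ i, p i ∈ G := by
        have hdir := hchain.directedOn
        have hp' (i : ι) : ∃ G ∈ c, p i ∈ G :=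
          (Submodule.mem_sSup_of_directed ⟨G₀, hG₀⟩ hdir).1 (hp i)
        choose G hGc hG using hp'
        have : Nonempty c := ⟨⟨G₀, hG₀⟩⟩
        obtain ⟨K, hK⟩ := hdir.directed_val.finite_le fun i => (⟨G i, hGc i⟩ : c)
        exact ⟨K, K.2, fun i => hK i (hG i)⟩
      obtain ⟨G, hGc, hpG⟩ := this
      exact hc hGc ι κ r p hpG hs) _ h₀
  have hGc : G.IsConsistent := hG.prop
  have htotal (n : N) : ∃ a, (n, a) ∈ G := by
    obtain ⟨a, ha⟩ := Submodule.PointedSystem.exists_forall_mem_sol hGc n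
    refine ⟨a, ?_⟩
    -- Multiples of `(n, a)` in the constants turn a system over the larger relation into a pointed
    -- system over `G`.
    have hcons : (G ⊔ Submodule.span R {(n, a)}).IsConsistent := by
      intro ι κ _ _ r p hp hs
      simp only [Submodule.mem_sup, Submodule.mem_span_singleton] at hp
      choose q hq _ hs' hqp using hp
      choose s hs' using hs'
      simp only [← hs', ← hqp] at hs ⊢
      exact ha ⟨ι, κ, r, s, q, hq⟩ hs
    exact hG.le_of_ge hcons le_sup_left
      (Submodule.mem_sup_right (Submodule.mem_span_singleton_self _))
  have huniq {a : A} (h : ((0 : N), a) ∈ G) : a = 0 := by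
    -- The system without unknowns whose only equation is `0 = constant`.
    obtain ⟨x, hx⟩ := hGc Unit Empty (fun _ => Empty.elim) (fun _ => (0, a)) (fun _ => h)
      ⟨Empty.elim, by simp⟩
    simpa using (hx ()).symm
  have huniq' {n : N} {a b : A} (ha : (n, a) ∈ G) (hb : (n, b) ∈ G) : a = b :=
    sub_eq_zero.1 (huniq (by simpa using G.sub_mem ha hb))
  choose h hh using htotal
  refine ⟨⟨⟨h, fun x y => huniq' (hh _) (by simpa using G.add_mem (hh x) (hh y))⟩,
    fun c x => huniq' (hh _) (by simpa using G.smul_mem c (hh x))⟩, ?_⟩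
  ext m
  exact huniq' (hh _) (hle ⟨m, rfl⟩)

/-! ### Modules with simple essential socle -/

section EssentialSocle

variable {R : Type u} [CommRing R] {E : Type*} [AddCommGroup E] [Module R E]

/-- The annihilator of a nonzero element lying in all nonzero submodules is maximal. -/
theorem Ideal.torsionOf_isMaximal_of_forall_mem {z : E} (hz : z ≠ 0)
    (h : ∀ N : Submodule R E, N ≠ ⊥ → z ∈ N) : (Ideal.torsionOf R E z).IsMaximal := by
  rw [Ideal.isMaximal_iff]
  refine ⟨by simpa using hz, fun J r hJ hr hrJ => ?_⟩
  have hr' : r • z ≠ 0 := by simpa using hr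
  obtain ⟨s, hs⟩ := Submodule.mem_span_singleton.1
    (h (Submodule.span R {r • z}) (by simpa using hr'))
  have h1 : 1 - s * r ∈ Ideal.torsionOf R E z := by
    simp [Ideal.mem_torsionOf_iff, sub_smul, mul_smul, hs]
  simpa using J.add_mem (hJ h1) (J.mul_mem_left s hrJ)

/-- If `z ≠ 0` lies in all nonzero submodules, then an element killed by the annihilator of `z`
is a multiple of `z`. -/
theorem exists_smul_eq_of_forall_mem {z : E} (hz : z ≠ 0)
    (h : ∀ N : Submodule R E, N ≠ ⊥ → z ∈ N) {y : E}
    (hy : ∀ c ∈ Ideal.torsionOf R E z, c • y = 0) : ∃ r : R, y = r • z := by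
  by_cases hy0 : y = 0
  · exact ⟨0, by simp [hy0]⟩
  obtain ⟨s, hs⟩ := Submodule.mem_span_singleton.1
    (h (Submodule.span R {y}) (by simpa using hy0))
  have hs' : s ∉ Ideal.torsionOf R E z := fun hs' => hz (hs ▸ hy s hs')
  obtain ⟨t, i, hi, hti⟩ := (Ideal.torsionOf_isMaximal_of_forall_mem hz h).exists_inv hs'
  refine ⟨t, ?_⟩
  rw [← hs, smul_smul]
  have := hy i hi
  calc y = (t * s + i) • y := by rw [hti, one_smul]
    _ = _ := by rw [add_smul, this, add_zero]

/-- If `z ≠ 0` lies in all nonzero submodules, then every element is killed by a power of the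
annihilator of `z`. -/
theorem exists_pow_torsionOf_smul_eq_zero [IsNoetherianRing R] {z : E} (hz : z ≠ 0)
    (h : ∀ N : Submodule R E, N ≠ ⊥ → z ∈ N) (x : E) :
    ∃ n, ∀ c ∈ Ideal.torsionOf R E z ^ n, c • x = 0 := by
  have hrad : Ideal.torsionOf R E z ≤ (Ideal.torsionOf R E x).radical := by
    intro a ha
    let I : ℕ →o Ideal R :=
      ⟨fun n => Ideal.torsionOf R E (a ^ n • x), monotone_nat_of_le_succ fun n r hr => by
        rw [Ideal.mem_torsionOf_iff] at hr ⊢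
        rw [pow_succ', mul_smul, smul_comm, hr, smul_zero]⟩
    obtain ⟨n, hn⟩ := monotone_stabilizes_iff_noetherian.2 ‹IsNoetherianRing R› I
    refine ⟨n, ?_⟩
    rw [Ideal.mem_torsionOf_iff]
    -- Otherwise `z = s • a ^ n • x`; as `a` kills `z`, stabilization makes `s` kill `a ^ n • x`, so
    -- `z = 0`.
    by_contra hne
    obtain ⟨s, hs⟩ := Submodule.mem_span_singleton.1
      (h (Submodule.span R {a ^ n • x}) (by simpa using hne))
    have hs1 : s ∈ I (n + 1) := by
      change s ∈ Ideal.torsionOf R E (a ^ (n + 1) • x)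
      rw [Ideal.mem_torsionOf_iff, pow_succ', mul_smul, smul_comm, hs]
      simpa using ha
    rw [← hn (n + 1) (Nat.le_succ n)] at hs1
    have : s • a ^ n • x = 0 := by simpa [I] using! hs1
    exact hz (hs ▸ this)
  obtain ⟨n, hn⟩ := Ideal.exists_pow_le_of_le_radical_of_fg hrad (IsNoetherian.noetherian _)
  exact ⟨n, fun c hc => by simpa using hn hc⟩

/-- The ideal of the Rees algebra of `I` formed by the polynomials whose coefficient of degree `n`
kills the elements of `F` that are killed by `I ^ (n + 1)`. -/
def Submodule.reesAnnihilator (F : Submodule R E) (I : Ideal R) : Ideal (reesAlgebra I) where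
  carrier := {p | ∀ n, ∀ x ∈ F, (∀ c ∈ I ^ (n + 1), c • x = 0) → (p : Polynomial R).coeff n • x = 0}
  add_mem' := by
    intro p q hp hq n x hx hc
    simp [add_smul, hp n x hx hc, hq n x hx hc]
  zero_mem' := by simp
  smul_mem' := by
    intro q p hp n x hx hc
    rw [smul_eq_mul, MulMemClass.coe_mul, Polynomial.coeff_mul, Finset.sum_smul]
    refine Finset.sum_eq_zero fun ij hij => ?_
    rw [mul_comm, mul_smul]
    refine hp ij.2 _ (F.smul_mem _ hx) fun c hc' => ?_
    rw [smul_smul]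
    apply hc
    rw [← Finset.HasAntidiagonal.mem_antidiagonal.1 hij, add_assoc, pow_add, mul_comm c]
    exact Ideal.mul_mem_mul (q.2 ij.1) hc'

theorem Submodule.reesAnnihilator_anti (I : Ideal R) {F F' : Submodule R E} (h : F ≤ F') :
    F'.reesAnnihilator I ≤ F.reesAnnihilator I :=
  fun _ hp n x hx => hp n x (h hx)

/-- The Rees annihilator determines the submodule when all nonzero submodules share a nonzero
element. -/
theorem Submodule.le_of_reesAnnihilator_le [IsNoetherianRing R] {z : E} (hz : z ≠ 0)
    (h : ∀ N : Submodule R E, N ≠ ⊥ → z ∈ N) {F F' : Submodule R E} (hF : F ≤ F')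
    (hJ : F.reesAnnihilator (Ideal.torsionOf R E z) ≤ F'.reesAnnihilator (Ideal.torsionOf R E z)) :
    F' ≤ F := by
  classical
  let I := Ideal.torsionOf R E z
  have hI : I.IsMaximal := Ideal.torsionOf_isMaximal_of_forall_mem hz h
  have hIz (r : R) : (Ideal.Quotient.mk I r = 0) ↔ r • z = 0 := by
    rw [Ideal.Quotient.eq_zero_iff_mem, Ideal.mem_torsionOf_iff]
  let _ : Field (R ⧸ I) := Ideal.Quotient.field I
  suffices H : ∀ n, ∀ x ∈ F', (∀ c ∈ I ^ n, c • x = 0) → x ∈ F by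
    intro x hx
    obtain ⟨n, hn⟩ := exists_pow_torsionOf_smul_eq_zero hz h x
    exact H n x hx hn
  intro n
  induction n with
  | zero =>
    intro x _ hx
    have : x = 0 := by simpa using hx 1
    simp [this]
  | succ n ih =>
    intro x hxF' hx
    obtain ⟨d, w, hw⟩ := Submodule.fg_iff_exists_fin_generating_family.1
      (IsNoetherian.noetherian (I ^ n))
    have hwI (i) : w i ∈ I ^ n := hw ▸ Submodule.subset_span ⟨i, rfl⟩
    have hsoc {y : E} (hy : ∀ c ∈ I ^ (n + 1), c • y = 0) : 
        ∃ r : Fin d → R, ∀ i, w i • y = r i • z := by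
      have hex (i : Fin d) : ∃ r : R, w i • y = r • z := by
        refine exists_smul_eq_of_forall_mem hz h fun c hc => ?_
        rw [smul_smul]
        apply hy
        rw [pow_succ']
        exact Ideal.mul_mem_mul hc (hwI i)
      exact ⟨fun i => (hex i).choose, fun i => (hex i).choose_spec⟩
    -- Modulo elements killed by `I ^ n`, `y` is determined by its coordinates `r i` in the residue
    -- field; `V` collects those coming from `F`.
    let V : Submodule (R ⧸ I) (Fin d → R ⧸ I) :=
      { carrier := {k | ∃ y ∈ F, (∀ c ∈ I ^ (n + 1), c • y = 0) ∧ ∃ r : Fin d → R,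
          (∀ i, Ideal.Quotient.mk I (r i) = k i) ∧ ∀ i, w i • y = r i • z}
        add_mem' := by
          rintro k k' ⟨y, hy, hyI, r, hr, hry⟩ ⟨y', hy', hyI', r', hr', hry'⟩
          exact ⟨y + y', F.add_mem hy hy', fun c hc => by simp [hyI c hc, hyI' c hc], r + r',
            fun i => by simp [hr, hr'], fun i => by simp [hry, hry', add_smul]⟩
        zero_mem' := ⟨0, F.zero_mem, by simp, 0, by simp, by simp⟩
        smul_mem' := by
          rintro a k ⟨y, hy, hyI, r, hr, hry⟩
          obtain ⟨a, rfl⟩ := Ideal.Quotient.mk_surjective a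
          exact ⟨a • y, F.smul_mem a hy, fun c hc => by rw [smul_comm, hyI c hc, smul_zero],
            a • r, fun i => by simp [hr], fun i => by
              rw [smul_comm, hry, Pi.smul_apply, smul_assoc]⟩ }
    obtain ⟨r, hr⟩ := hsoc hx
    by_cases hV : (fun i => Ideal.Quotient.mk I (r i)) ∈ V
    · obtain ⟨y, hy, hyI, r', hr', hry⟩ := hV
      have hxy : x - y ∈ F := by
        refine ih _ (F'.sub_mem hxF' (hF hy)) fun c hc => ?_
        rw [← hw] at hc
        induction hc using Submodule.span_induction with
        | mem c hc =>
          obtain ⟨i, rfl⟩ := hc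
          have : (r i - r' i) • z = 0 := by rw [← hIz, map_sub, hr', sub_self]
          rw [smul_sub, hr, hry, ← sub_smul, this]
        | zero => simp
        | add a b _ _ ha hb => rw [add_smul, ha, hb, add_zero]
        | smul a b _ hb => rw [smul_assoc, hb, smul_zero]
      simpa using F.add_mem hxy hy
    · exfalso
      -- A functional separating `x` from `V` lifts to `b ∈ I ^ n`; the degree `n` monomial of `b`
      -- annihilates for `F` but not for `F'`.
      obtain ⟨f, hf, hVf⟩ := Submodule.exists_le_ker_of_notMem hV
      choose c hc using fun i => Ideal.Quotient.mk_surjective (I := I) (f (Pi.single i 1))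
      have hfk (r : Fin d → R) : f (fun i => Ideal.Quotient.mk I (r i)) =
          Ideal.Quotient.mk I (∑ i, c i * r i) := by
        rw [pi_eq_sum_univ' (fun i => Ideal.Quotient.mk I (r i))]
        simp [hc, mul_comm]
      let b := ∑ i, c i * w i
      have hb : b ∈ I ^ n := Ideal.sum_mem _ fun i _ => Ideal.mul_mem_left _ _ (hwI i)
      have hby {y : E} {r : Fin d → R} (hr : ∀ i, w i • y = r i • z) :
          b • y = (∑ i, c i * r i) • z := by
        simp [b, Finset.sum_smul, mul_smul, hr]
      have hmem : (⟨Polynomial.monomial n b, reesAlgebra.monomial_mem.2 hb⟩ : reesAlgebra I) ∈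
          F.reesAnnihilator I := by
        intro j y hy hyI
        rw [Polynomial.coeff_monomial]
        split_ifs with hj
        · subst hj
          obtain ⟨r, hr⟩ := hsoc hyI
          rw [hby hr, ← hIz, ← hfk]
          exact hVf ⟨y, hy, hyI, r, fun _ => rfl, hr⟩
        · simp
      have := hJ hmem n x hxF' hx
      rw [Polynomial.coeff_monomial, if_pos rfl, hby hr, ← hIz, ← hfk] at this
      exact hf this

/-- Over a Noetherian commutative ring, a module whose nonzero submodules share a nonzero element
is Artinian. -/
theorem isArtinian_of_forall_mem [IsNoetherianRing R] {z : E} (hz : z ≠ 0)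
    (h : ∀ N : Submodule R E, N ≠ ⊥ → z ∈ N) : IsArtinian R E := by
  have : StrictAnti fun F : Submodule R E => F.reesAnnihilator (Ideal.torsionOf R E z) :=
    fun F F' hlt => lt_of_le_not_ge (Submodule.reesAnnihilator_anti _ hlt.le) fun hle =>
      hlt.not_ge (Submodule.le_of_reesAnnihilator_le hz h hlt.le hle)
  exact this.wellFoundedLT

/-- Every nonzero element of a module over a Noetherian commutative ring survives in an Artinian
quotient. -/
theorem exists_isArtinian_quotient_of_ne_zero [IsNoetherianRing R] {x : E} (hx : x ≠ 0) :
    ∃ K : Submodule R E, x ∉ K ∧ IsArtinian R (E ⧸ K) := by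
  -- For `K` maximal avoiding `x`, the image of `x` lies in every nonzero submodule of `E ⧸ K`.
  obtain ⟨K, -, hK⟩ := zorn_le_nonempty₀ {K : Submodule R E | x ∉ K}
    (by
      intro c hc hchain K₀ hK₀
      refine ⟨sSup c, fun hmem => ?_, fun K hK => le_sSup hK⟩
      obtain ⟨K, hK, hxK⟩ := (Submodule.mem_sSup_of_directed ⟨K₀, hK₀⟩ hchain.directedOn).1 hmem
      exact hc hK hxK) ⊥ (by simpa using hx)
  have hxK : x ∉ K := hK.prop
  refine ⟨K, hxK, isArtinian_of_forall_mem (z := K.mkQ x) (by simpa using hxK) fun N hN => ?_⟩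
  by_contra hxN
  have hle : K ≤ N.comap K.mkQ := by
    intro y hy
    simp [(Submodule.Quotient.mk_eq_zero K).2 hy]
  have := hK.le_of_ge (y := N.comap K.mkQ) hxN hle
  apply hN
  rw [eq_bot_iff]
  intro y hy
  obtain ⟨y, rfl⟩ := K.mkQ_surjective y
  simpa using this hy

end EssentialSocle

/-! ### Pure embedding in a product of Artinian modules -/

/-- A surjection `Rⁿ → L` embeds `Hom(L, E)` in `Eⁿ`. -/
theorem IsArtinian.linearMap {R L E : Type*} [CommRing R] [AddCommGroup L] [Module R L]
    [Module.Finite R L] [AddCommGroup E] [Module R E] [IsArtinian R E] :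
    IsArtinian R (L →ₗ[R] E) := by
  obtain ⟨n, q, hq⟩ := Module.Finite.exists_fin' R L
  refine isArtinian_of_injective
    ((LinearMap.pi fun i => LinearMap.applyₗ (q (Pi.single i 1))) : (L →ₗ[R] E) →ₗ[R] Fin n → E) ?_
  intro f g hfg
  have : f ∘ₗ q = g ∘ₗ q := by
    refine LinearMap.pi_ext' fun i => LinearMap.ext_ring ?_
    simpa using congrFun hfg i
  exact LinearMap.cancel_right hq |>.1 this

/-- The injectivity of `f ⊗ L` for all `L` follows from the case of the finitely generated modules
`Rⁿ ⧸ K`. -/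
theorem LinearMap.rTensor_injective_of_fin {R : Type u} [CommRing R]
    {M : Type w₁} {N : Type w₂} [AddCommGroup M] [Module R M] [AddCommGroup N] [Module R N]
    (f : M →ₗ[R] N)
    (h : ∀ (n : ℕ) (K : Submodule R (Fin n → R)),
      Function.Injective (f.rTensor ((Fin n → R) ⧸ K)))
    (L : Type*) [AddCommGroup L] [Module R L] : Function.Injective (f.rTensor L) := by
  have hfin (L' : Submodule R L) (hL' : L'.FG) : Function.Injective (f.rTensor L') := by
    have : Module.Finite R L' := Module.Finite.iff_fg.2 hL'
    obtain ⟨n, q, hq⟩ := Module.Finite.exists_fin' R L'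
    let e := q.quotKerEquivOfSurjective hq
    have hcomm (x : TensorProduct R M L') :
        f.rTensor _ (e.symm.toLinearMap.lTensor M x) =
          e.symm.toLinearMap.lTensor N (f.rTensor L' x) := by
      rw [← LinearMap.comp_apply, LinearMap.rTensor_comp_lTensor,
        ← LinearMap.lTensor_comp_rTensor, LinearMap.comp_apply]
    intro x y hxy
    apply (e.symm.lTensor M).injective
    apply h n (LinearMap.ker q)
    change f.rTensor _ (e.symm.toLinearMap.lTensor M x) =
      f.rTensor _ (e.symm.toLinearMap.lTensor M y)
    rw [hcomm, hcomm, hxy]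
  rw [← LinearMap.lTensor_inj_iff_rTensor_inj, injective_iff_map_eq_zero]
  intro x hx
  -- A tensor, and the vanishing of its image, are both witnessed on finitely generated submodules
  -- of `L`.
  obtain ⟨L₀, hL₀, x₀, rfl⟩ := TensorProduct.exists_of_fg x
  rw [← LinearMap.comp_apply, LinearMap.lTensor_comp_rTensor, ← LinearMap.rTensor_comp_lTensor,
    LinearMap.comp_apply] at hx
  obtain ⟨L₁, hle, hL₁, h₁⟩ := TensorProduct.eq_zero_of_fg_of_subtype_eq_zero hL₀ hx
  have hx₁ : (Submodule.inclusion hle).rTensor M x₀ = 0 := by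
    apply (LinearMap.lTensor_inj_iff_rTensor_inj _ _).2 (hfin L₁ hL₁)
    rw [map_zero, ← h₁, ← LinearMap.comp_apply, ← LinearMap.comp_apply,
      LinearMap.rTensor_comp_lTensor, LinearMap.lTensor_comp_rTensor]
  rw [← Submodule.subtype_comp_inclusion _ _ hle, LinearMap.rTensor_comp, LinearMap.comp_apply,
    hx₁, map_zero]

/-- A nonzero element of `D ⊗ Q` with `Q` finitely generated is detected by a homomorphism from
`D` into an Artinian module. -/
theorem TensorProduct.exists_isArtinian_rTensor_ne_zero {R : Type u} [CommRing R]
    [IsNoetherianRing R] {D : Type v} [AddCommGroup D] [Module R D] {Q : Type u} [AddCommGroup Q]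
    [Module R Q] [Module.Finite R Q] {z : TensorProduct R D Q} (hz : z ≠ 0) :
    ∃ (A : Type (max u v)) (_ : AddCommGroup A) (_ : Module R A) (f : D →ₗ[R] A),
      IsArtinian R A ∧ f.rTensor Q z ≠ 0 := by
  obtain ⟨S, hS, _⟩ := exists_isArtinian_quotient_of_ne_zero (R := R) hz
  refine ⟨Q →ₗ[R] TensorProduct R D Q ⧸ S, inferInstance, inferInstance,
    TensorProduct.curry S.mkQ, IsArtinian.linearMap, fun h => hS ?_⟩
  -- Evaluation at `Q` recovers the quotient map from its curried form.
  have hev : TensorProduct.lift LinearMap.id ∘ₗ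
      (TensorProduct.curry S.mkQ).rTensor Q = S.mkQ := TensorProduct.ext' fun x y => by simp
  rw [← Submodule.Quotient.mk_eq_zero, ← S.mkQ_apply, ← hev, LinearMap.comp_apply, h, map_zero]

/-- Every module over a Noetherian commutative ring is a pure submodule of a product of Artinian
modules. -/
theorem Module.exists_rTensor_injective_pi_isArtinian (R : Type u) [CommRing R]
    [IsNoetherianRing R] (D : Type v) [AddCommGroup D] [Module R D] :
    ∃ (ι : Type (max u v)) (A : ι → Type (max u v))
      (_ : ∀ i, AddCommGroup (A i)) (_ : ∀ i, Module R (A i)) (f : D →ₗ[R] ∀ i, A i),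
      (∀ i, IsArtinian R (A i)) ∧
        ∀ (L : Type (max u v)) [AddCommGroup L] [Module R L], Function.Injective (f.rTensor L) := by
  -- Testing only the modules `Rⁿ ⧸ K` keeps the index type small.
  let ι : Type (max u v) := Σ (n : ℕ) (K : Submodule R (Fin n → R)),
    {z : TensorProduct R D ((Fin n → R) ⧸ K) // z ≠ 0}
  choose A _ _ φ hA hφ using fun i : ι =>
    TensorProduct.exists_isArtinian_rTensor_ne_zero i.2.2.2
  refine ⟨ι, A, _, _, LinearMap.pi φ, hA,
    fun L _ _ => LinearMap.rTensor_injective_of_fin _ (fun n K => ?_) L⟩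
  rw [injective_iff_map_eq_zero]
  intro z hz
  by_contra hne
  apply hφ ⟨n, K, z, hne⟩
  change (φ ⟨n, K, z, hne⟩).rTensor ((Fin n → R) ⧸ K) z = 0
  rw [← LinearMap.proj_pi φ ⟨n, K, z, hne⟩, LinearMap.rTensor_comp, LinearMap.comp_apply, hz,
    map_zero]

/-! ### Direct summands and the equivalence -/

/-- A module that is a retract of `P` is isomorphic to a direct summand of `P`. -/
theorem Module.isIsoDirectSummand_of_comp_eq_id {R : Type u} [CommRing R] {D : Type w₁}
    {P : Type w₂} [AddCommGroup D] [Module R D] [AddCommGroup P] [Module R P]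
    {i : D →ₗ[R] P} {r : P →ₗ[R] D} (h : r ∘ₗ i = LinearMap.id) :
    Module.IsIsoDirectSummand R D P := by
  have hri (x : D) : r (i x) = x := LinearMap.congr_fun h x
  refine ⟨LinearMap.range i, LinearMap.ker r, ?_,
    ⟨LinearEquiv.ofInjective i (Function.LeftInverse.injective hri)⟩⟩
  constructor
  · rw [Submodule.disjoint_def]
    rintro _ ⟨x, rfl⟩ hx
    rw [LinearMap.mem_ker, hri] at hx
    rw [hx, map_zero]
  · rw [codisjoint_iff, eq_top_iff]
    intro p _
    exact Submodule.mem_sup.2 ⟨i (r p), ⟨_, rfl⟩, p - i (r p), by simp [hri], by simp⟩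

/-- A direct summand of a product of Artinian modules is pure injective. -/
theorem Module.IsIsoDirectSummand.isPureInjective {R : Type u} [CommRing R] {D : Type v}
    [AddCommGroup D] [Module R D] {ι : Type*} {A : ι → Type*} [∀ i, AddCommGroup (A i)]
    [∀ i, Module R (A i)] (hA : ∀ i, IsArtinian R (A i))
    (h : Module.IsIsoDirectSummand R D (∀ i, A i)) : Module.IsPureInjective R D := by
  intro M N _ _ _ _ f hf g
  obtain ⟨C, C', hC, ⟨e⟩⟩ := h
  choose k hk using fun i =>
    hf.exists_extension_of_isArtinian (LinearMap.proj i ∘ₗ C.subtype ∘ₗ e.toLinearMap ∘ₗ g)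
  refine ⟨e.symm.toLinearMap ∘ₗ C.projectionOnto C' hC ∘ₗ LinearMap.pi k, ?_⟩
  ext m
  have : LinearMap.pi k (f m) = (e (g m) : ∀ i, A i) := by
    ext i
    exact LinearMap.congr_fun (hk i) m
  simp [this, Submodule.projectionOnto_apply_left]

theorem theorem2p8 (R : Type u) [CommRing R] [IsNoetherianRing R]
    (D : Type v) [AddCommGroup D] [Module R D] :
    Module.IsPureInjective R D ↔
      ∃ (ι : Type (max u v)) (A : ι → Type (max u v))
        (_ : ∀ i, AddCommGroup (A i)) (_ : ∀ i, Module R (A i)),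
        (∀ i, IsArtinian R (A i)) ∧ Module.IsIsoDirectSummand R D (∀ i, A i) := by
  constructor
  · intro hD
    obtain ⟨ι, A, _, _, f, hA, hf⟩ :=
      Module.exists_rTensor_injective_pi_isArtinian R (ULift.{max u v} D)
    have hinj : Function.Injective f := by
      intro x y hxy
      -- Tensoring with a copy of `R` recovers `f` itself.
      have := @hf (ULift.{max u v} R) _ _ (x ⊗ₜ ULift.up 1) (y ⊗ₜ ULift.up 1) (by simp [hxy])
      simpa using congrArg (TensorProduct.rid R _ ∘ ULift.moduleEquiv.toLinearMap.lTensor _) this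
    obtain ⟨r, hr⟩ := hD _ _ f ⟨hinj, hf⟩ (ULift.moduleEquiv (R := R)).toLinearMap
    refine ⟨ι, A, _, _, hA, Module.isIsoDirectSummand_of_comp_eq_id
      (i := f ∘ₗ (ULift.moduleEquiv (R := R)).symm.toLinearMap) (r := r) ?_⟩
    rw [← LinearMap.comp_assoc]
    ext x
    simpa using LinearMap.congr_fun hr (ULift.up x)
  · rintro ⟨ι, A, _, _, hA, h⟩
    exact h.isPureInjective hA
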